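/- Let $-\infty<a<b<\infty$. For $\gamma>0$ and $g\in C[a,b]$ let $$J_a^{\gamma}g(x)=\frac1{\Gamma(\gamma)}\int_a^x (x-t)^{\gamma-1}g(t)\,dt\quad(a\le x\le b),\qquad J_a^0g=g .$$ For $\alpha>0$ put $m=\lceil\alpha\rceil$. A function $f:[a,b]\to\mathbb R$ of class $C^{m-1}[a,b]$, with Taylor polynomial $T_{m-1}[f;a](t)=\sum_{k=0}^{m-1}\frac{f^{(k)}(a)}{k!}(t-a)^k$, is called continuously Caputo $\alpha$-differentiable if the derivative $${}^{C}\!D_a^{\alpha}f:=D^mJ_a^{m-\alpha}\bigl(f-T_{m-1}[f;a]\bigr)$$ exists and is continuous on $[a,b]$, i.e. if $J_a^{m-\alpha}(f-T_{m-1}[f;a])\in C^m[a,b]$ (derivatives at the end points are one-sided). For $\alpha=0$, ${}^{C}\!D_a^{0}f:=f$, and $f$ is continuously Caputo $0$-differentiable if $f\in C[a,b]$. **Theorem.** Let $\alpha>0$ and $\lceil\alpha\rceil-1\le\beta<\alpha$, and let $f\in C^{\lceil\alpha\rceil-1}[a,b]$ be continuously Caputo $\alpha$-differentiable. Then: (i)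 $f$ is continuously Caputo $\beta$-differentiable, with continuous derivative ${}^{C}\!D_a^{\beta}f\in C[a,b]$. Moreover, if $\beta\notin\mathbb N=\{0,1,2,\dots\}$, then $({}^{C}\!D_a^{\beta}f)(a)=0$. (ii) The function $f_1:={}^{C}\!D_a^{\beta}f$ is continuously Caputo $(\alpha-\beta)$-differentiable, and ${}^{C}\!D_a^{\alpha-\beta}f_1={}^{C}\!D_a^{\alpha}f$ on $[a,b]$; thus ${}^{C}\!D_a^{\alpha-\beta}\,{}^{C}\!D_a^{\beta}f={}^{C}\!D_a^{\alpha}f$. -/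

import Mathlib

namespace FracCalc

noncomputable section

/-- Riemann-Liouville fractional integral `J_a^α f` of order `α`, with `J_a^0` the identity. -/
def rlIntegral (a α : ℝ) (f : ℝ → ℝ) (x : ℝ) : ℝ :=
  if α = 0 then f x
  else 1 / Real.Gamma α * ∫ t in a..x, (x - t) ^ (α - 1) * f t

/-- Riemann-Liouville fractional derivative `D^m J_a^(m - α) f` on `[a, b]`, `m = ⌈α⌉`, where the
ordinary derivatives are taken within `[a, b]` (one-sided at the end points). For `α = 0` this
is `f` itself. -/
def rlDeriv (a b α : ℝ) (f : ℝ → ℝ) (x : ℝ) : ℝ :=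
  iteratedDerivWithin ⌈α⌉₊ (rlIntegral a (⌈α⌉₊ - α) f) (Set.Icc a b) x

/-- `f - T_{m-1}[f; a]`, where `T_{m-1}[f; a]` is the Taylor polynomial of `f` of order `m - 1`,
`m = ⌈α⌉`, centered at `a`. Only used for `0 < α`, so that `1 ≤ m`. -/
def taylorRemainder (a b α : ℝ) (f : ℝ → ℝ) (x : ℝ) : ℝ :=
  f x - taylorWithinEval f (⌈α⌉₊ - 1) (Set.Icc a b) a x

/-- Caputo fractional derivative of order `α` on `[a, b]`: the Riemann-Liouville derivative of
`f - T_{m-1}[f; a]`, and the identity for `α = 0`. -/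
def caputoDeriv (a b α : ℝ) (f : ℝ → ℝ) (x : ℝ) : ℝ :=
  if α = 0 then f x else rlDeriv a b α (taylorRemainder a b α f) x

/-- `f` is continuously Caputo `α`-differentiable on `[a, b]`: for `0 < α` and `m = ⌈α⌉`, the
function `f` is in `C^(m-1)[a, b]`, and `D^m J_a^(m - α) (f - T_{m-1}[f; a])` exists and is
continuous on `[a, b]`, that is, `J_a^(m - α) (f - T_{m-1}[f; a])` is in `C^m[a, b]`.
For `α = 0` it says that `f` is in `C[a, b]`. -/
def ContCaputoDiff (a b α : ℝ) (f : ℝ → ℝ) : Prop :=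
  if α = 0 then ContinuousOn f (Set.Icc a b)
  else
    ContDiffOn ℝ ((⌈α⌉₊ - 1 : ℕ) : WithTop ℕ∞) f (Set.Icc a b) ∧
    ContDiffOn ℝ (⌈α⌉₊ : WithTop ℕ∞)
      (rlIntegral a (⌈α⌉₊ - α) (taylorRemainder a b α f)) (Set.Icc a b)

end

end FracCalc

/-!
The Riemann-Liouville integrals form a semigroup on `C[a, b]`: exchanging the order of integration
over the triangle `a ≤ s ≤ t ≤ x` turns the iterated integral into a single one whose kernel is a
beta integral. Each of them is injective, since `J^(n - γ) J^γ = J^n` is inverted by `D^n`.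

For `k < α ≤ k + 1`, Taylor's formula `f - T_k[f; a] = J^k (f^(k) - f^(k)(a))` reduces Caputo
differentiability to the single equation `f^(k) - f^(k)(a) = J^(α - k) φ` with `φ` continuous, in
which `φ` is the Caputo derivative. For `k < β < α` the theorem is then read off from
`J^(α - k) φ = J^(β - k) J^(α - β) φ`: the Caputo derivative of order `β` is `J^(α - β) φ`, which
vanishes at `a` and has `φ` as its Caputo derivative of order `α - β`. For `β = k` it is `f^(k)`,
and the equation itself says that `φ` is the Caputo derivative of `f^(k)` of order `α - k`.
-/

namespace FracCalc

open Set MeasureTheory intervalIntegral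

section TriangleIntegral

/-- The triangle `a < s ≤ t ≤ x` of pairs `(s, t)`, over which an iterated integral with variable
upper limit is a double integral. -/
def triangle (a x : ℝ) : Set (ℝ × ℝ) := {p | a < p.1 ∧ p.1 ≤ p.2 ∧ p.2 ≤ x}

theorem measurableSet_triangle (a x : ℝ) : MeasurableSet (triangle a x) :=
  (measurableSet_lt measurable_const measurable_fst).inter
    ((measurableSet_le measurable_fst measurable_snd).inter
      (measurableSet_le measurable_snd measurable_const))

theorem indicator_triangle_eq_indicator_Ioc_snd {E : Type*} [Zero E] (F : ℝ → ℝ → E)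
    (a x s t : ℝ) :
    (triangle a x).indicator F.uncurry (s, t) =
      (Ioc a x).indicator (fun t ↦ (Ioc a t).indicator (F · t) s) t := by
  simp only [indicator, triangle, mem_ofPred_eq, mem_Ioc, Function.uncurry]
  grind

theorem indicator_triangle_eq_indicator_Ioc_fst {E : Type*} [Zero E] (F : ℝ → ℝ → E)
    (a x s t : ℝ) :
    (triangle a x).indicator F.uncurry (s, t) =
      (Ioc a x).indicator (fun s ↦ (Icc s x).indicator (F s) t) s := by
  simp only [indicator, triangle, mem_ofPred_eq, mem_Ioc, mem_Icc, Function.uncurry]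
  grind

theorem integral_integral_triangle_swap {E : Type*} [NormedAddCommGroup E] [NormedSpace ℝ E]
    {a x : ℝ} (hax : a ≤ x) {F : ℝ → ℝ → E} (hF : IntegrableOn F.uncurry (triangle a x)) :
    ∫ t in a..x, ∫ s in a..t, F s t = ∫ s in a..x, ∫ t in s..x, F s t := by
  have hupper (t : ℝ) : ∫ s, (triangle a x).indicator F.uncurry (s, t) =
      (Ioc a x).indicator (fun t ↦ ∫ s in a..t, F s t) t := by
    simp only [indicator_triangle_eq_indicator_Ioc_snd]
    by_cases ht : t ∈ Ioc a x
    · simp only [indicator_of_mem ht]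
      rw [MeasureTheory.integral_indicator measurableSet_Ioc, integral_of_le ht.1.le]
    · simp only [indicator_of_notMem ht, integral_zero]
  have hlower (s : ℝ) : ∫ t, (triangle a x).indicator F.uncurry (s, t) =
      (Ioc a x).indicator (fun s ↦ ∫ t in s..x, F s t) s := by
    simp only [indicator_triangle_eq_indicator_Ioc_fst]
    by_cases hs : s ∈ Ioc a x
    · simp only [indicator_of_mem hs]
      rw [MeasureTheory.integral_indicator measurableSet_Icc, integral_of_le hs.2,
        integral_Icc_eq_integral_Ioc]
    · simp only [indicator_of_notMem hs, integral_zero]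
  rw [← integrable_indicator_iff (measurableSet_triangle a x), Measure.volume_eq_prod] at hF
  have hswap := integral_integral_swap
    (f := fun s t ↦ (triangle a x).indicator F.uncurry (s, t)) hF
  simp only [hupper, hlower, MeasureTheory.integral_indicator measurableSet_Ioc] at hswap
  rw [integral_of_le hax, integral_of_le hax, hswap]

theorem integrableOn_triangle_mul_sub_mul {a x : ℝ} (hax : a ≤ x) {u v g : ℝ → ℝ}
    (hu : IntervalIntegrable u volume a x) (hv : IntervalIntegrable v volume 0 (x - a))
    (hg : ContinuousOn g (Icc a x)) :
    IntegrableOn (fun p : ℝ × ℝ ↦ u p.2 * v (p.2 - p.1) * g p.1) (triangle a x) := by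
  have hmem {p : ℝ × ℝ} (hp : p ∈ triangle a x) :
      p.1 ∈ Icc a x ∧ p.2 ∈ Icc a x ∧ p.2 - p.1 ∈ Icc 0 (x - a) := by
    obtain ⟨h1, h2, h3⟩ := hp
    exact ⟨⟨h1.le, h2.trans h3⟩, ⟨h1.le.trans h2, h3⟩, sub_nonneg.2 h2, by linarith⟩
  rw [intervalIntegrable_iff_integrableOn_Icc_of_le hax,
    ← integrable_indicator_iff measurableSet_Icc] at hu
  rw [intervalIntegrable_iff_integrableOn_Icc_of_le (sub_nonneg.2 hax),
    ← integrable_indicator_iff measurableSet_Icc] at hv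
  have hconv : IntegrableOn (fun p : ℝ × ℝ ↦ u p.2 * v (p.2 - p.1)) (triangle a x) := by
    have hprod := hu.convolution_integrand (ContinuousLinearMap.mul ℝ ℝ) hv.comp_neg
    refine hprod.integrableOn.congr_fun (fun p hp ↦ ?_) (measurableSet_triangle a x)
    obtain ⟨-, hp2, hsub⟩ := hmem hp
    rw [← neg_sub p.1 p.2] at hsub ⊢
    simp only [ContinuousLinearMap.mul_apply', indicator_of_mem hp2, indicator_of_mem hsub]
  obtain ⟨C, hC⟩ := isCompact_Icc.exists_bound_of_continuousOn hg
  refine hconv.mul_bdd (c := C) ?_ ?_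
  · exact (hg.comp continuousOn_fst fun p hp ↦ (hmem hp).1).aestronglyMeasurable
      (measurableSet_triangle a x)
  · exact ae_restrict_of_forall_mem (measurableSet_triangle a x) fun p hp ↦ hC _ (hmem hp).1

end TriangleIntegral

section BetaIntegral

variable {γ δ : ℝ}

theorem intervalIntegrable_sub_rpow (hγ : 0 < γ) (x c d : ℝ) :
    IntervalIntegrable (fun t ↦ (x - t) ^ (γ - 1)) volume c d := by
  simpa using (intervalIntegrable_rpow' (a := x - c) (b := x - d)
    (show -1 < γ - 1 by linarith)).comp_sub_left x

theorem integral_rpow_mul_sub_rpow (hγ : 0 < γ) (hδ : 0 < δ) {c : ℝ} (hc : 0 < c) :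
    ∫ r in 0..c, r ^ (γ - 1) * (c - r) ^ (δ - 1) =
      ProbabilityTheory.beta γ δ * c ^ (γ + δ - 1) := by
  have hscaled := Complex.betaIntegral_scaled γ δ hc
  rw [Complex.betaIntegral_eq_Gamma_mul_div _ _ (by simpa) (by simpa)] at hscaled
  have hcast : ((∫ r in 0..c, r ^ (γ - 1) * (c - r) ^ (δ - 1) : ℝ) : ℂ) =
      ∫ r in 0..c, (r : ℂ) ^ ((γ : ℂ) - 1) * ((c : ℂ) - r) ^ ((δ : ℂ) - 1) := by
    rw [← intervalIntegral.integral_ofReal]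
    refine integral_congr fun r hr ↦ ?_
    rw [uIcc_of_le hc.le] at hr
    push_cast [Complex.ofReal_cpow hr.1, Complex.ofReal_cpow (sub_nonneg.2 hr.2)]
    rfl
  apply Complex.ofReal_injective
  rw [hcast, hscaled]
  push_cast [ProbabilityTheory.beta, Complex.ofReal_cpow hc.le, ← Complex.Gamma_ofReal]
  ring

theorem integral_sub_rpow_mul_sub_rpow (hγ : 0 < γ) (hδ : 0 < δ) {s x : ℝ} (hsx : s < x) :
    ∫ t in s..x, (x - t) ^ (γ - 1) * (t - s) ^ (δ - 1) =
      ProbabilityTheory.beta γ δ * (x - s) ^ (γ + δ - 1) := by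
  rw [← integral_rpow_mul_sub_rpow hγ hδ (sub_pos.2 hsx)]
  simpa using integral_comp_sub_left (a := s) (b := x)
    (fun r ↦ r ^ (γ - 1) * ((x - s) - r) ^ (δ - 1)) x

end BetaIntegral

section RiemannLiouville

variable {a b γ δ ε : ℝ} {g h : ℝ → ℝ}

theorem rlIntegral_zero (a : ℝ) (g : ℝ → ℝ) : rlIntegral a 0 g = g := by
  ext x
  simp [rlIntegral]

theorem rlIntegral_of_pos (hγ : 0 < γ) (a : ℝ) (g : ℝ → ℝ) (x : ℝ) :
    rlIntegral a γ g x = 1 / Real.Gamma γ * ∫ t in a..x, (x - t) ^ (γ - 1) * g t := by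
  simp [rlIntegral, hγ.ne']

theorem rlIntegral_one (a : ℝ) (g : ℝ → ℝ) : rlIntegral a 1 g = fun x ↦ ∫ t in a..x, g t := by
  ext x
  simp [rlIntegral]

theorem rlIntegral_left (hγ : 0 < γ) (a : ℝ) (g : ℝ → ℝ) : rlIntegral a γ g a = 0 := by
  simp [rlIntegral_of_pos hγ]

theorem rlIntegral_congr (γ : ℝ) (hgh : EqOn g h (Icc a b)) :
    EqOn (rlIntegral a γ g) (rlIntegral a γ h) (Icc a b) := by
  intro x hx
  unfold rlIntegral
  split_ifs
  · exact hgh hx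
  · congr 1
    refine integral_congr fun t ht ↦ ?_
    rw [uIcc_of_le hx.1] at ht
    simp only [hgh ⟨ht.1, ht.2.trans hx.2⟩]

theorem rlIntegral_eq_rpow_mul_integral (hγ : 0 < γ) {x : ℝ} (hx : a ≤ x) (g : ℝ → ℝ) :
    rlIntegral a γ g x = 1 / Real.Gamma γ *
      ((x - a) ^ γ * ∫ u in 0..1, (1 - u) ^ (γ - 1) * g (a + u * (x - a))) := by
  rw [rlIntegral_of_pos hγ]
  congr 1
  rcases hx.eq_or_lt with rfl | hx
  · simp [Real.zero_rpow hγ.ne']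
  have hpos : 0 < x - a := sub_pos.2 hx
  have hpow : (x - a) ^ γ = (x - a) * (x - a) ^ (γ - 1) := by
    rw [← Real.rpow_one_add' hpos.le (by linarith), add_sub_cancel]
  calc ∫ t in a..x, (x - t) ^ (γ - 1) * g t
      = (x - a) * ∫ u in 0..1, (x - (a + (x - a) * u)) ^ (γ - 1) * g (a + (x - a) * u) := by
        simpa using (smul_integral_comp_add_mul (a := 0) (b := 1)
          (fun t : ℝ ↦ (x - t) ^ (γ - 1) * g t) (x - a) a).symm
    _ = (x - a) * ∫ u in 0..1,
          (x - a) ^ (γ - 1) * ((1 - u) ^ (γ - 1) * g (a + u * (x - a))) := by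
        congr 1
        refine integral_congr fun u hu ↦ ?_
        rw [uIcc_of_le zero_le_one] at hu
        rw [show x - (a + (x - a) * u) = (x - a) * (1 - u) by ring,
          Real.mul_rpow hpos.le (sub_nonneg.2 hu.2), mul_assoc, mul_comm u]
    _ = (x - a) ^ γ * ∫ u in 0..1, (1 - u) ^ (γ - 1) * g (a + u * (x - a)) := by
        rw [intervalIntegral.integral_const_mul, hpow, mul_assoc]

theorem continuousOn_integral_mul_comp_add_mul_sub {w : ℝ → ℝ}
    (hw : IntervalIntegrable w volume 0 1) (hg : ContinuousOn g (Icc a b)) :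
    ContinuousOn (fun x ↦ ∫ u in 0..1, w u * g (a + u * (x - a))) (Icc a b) := by
  obtain ⟨C, hC⟩ := isCompact_Icc.exists_bound_of_continuousOn hg
  have hmem {x u : ℝ} (hx : x ∈ Icc a b) (hu : u ∈ uIoc (0 : ℝ) 1) :
      a + u * (x - a) ∈ Icc a b := by
    rw [uIoc_of_le zero_le_one] at hu
    exact (convex_Icc a b).add_smul_sub_mem (left_mem_Icc.2 (hx.1.trans hx.2)) hx
      (Ioc_subset_Icc_self hu)
  intro x₀ hx₀
  refine continuousWithinAt_of_dominated_interval (bound := fun u ↦ ‖w u‖ * C) ?_ ?_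
    (hw.norm.mul_const C) (.of_forall fun u hu ↦ continuousWithinAt_const.mul ?_)
  · filter_upwards [self_mem_nhdsWithin] with x hx
    refine (intervalIntegrable_iff.1 hw).aestronglyMeasurable.mul ?_
    exact (hg.comp (by fun_prop) fun u hu ↦ hmem hx hu).aestronglyMeasurable measurableSet_uIoc
  · filter_upwards [self_mem_nhdsWithin] with x hx
    refine .of_forall fun u hu ↦ (norm_mul_le _ _).trans ?_
    gcongr
    exact hC _ (hmem hx hu)
  · exact ContinuousWithinAt.comp (f := fun x ↦ a + u * (x - a)) (hg _ (hmem hx₀ hu))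
      (by fun_prop) fun x hx ↦ hmem hx hu

theorem continuousOn_rlIntegral (hγ : 0 ≤ γ) (hg : ContinuousOn g (Icc a b)) :
    ContinuousOn (rlIntegral a γ g) (Icc a b) := by
  rcases hγ.eq_or_lt with rfl | hγ
  · rwa [rlIntegral_zero]
  have hpow : ContinuousOn (fun x ↦ (x - a) ^ γ) (Icc a b) :=
    (continuousOn_id.sub continuousOn_const).rpow_const fun _ _ ↦ Or.inr hγ.le
  have hint := continuousOn_integral_mul_comp_add_mul_sub (intervalIntegrable_sub_rpow hγ 1 0 1) hg
  exact (continuousOn_const.mul (hpow.mul hint)).congr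
    fun x hx ↦ rlIntegral_eq_rpow_mul_integral hγ hx.1 g

theorem integral_sub_rpow_mul_integral_sub_rpow_mul (hγ : 0 < γ) (hδ : 0 < δ) {x : ℝ}
    (hax : a ≤ x) (hg : ContinuousOn g (Icc a x)) :
    ∫ t in a..x, (x - t) ^ (γ - 1) * ∫ s in a..t, (t - s) ^ (δ - 1) * g s =
      ProbabilityTheory.beta γ δ * ∫ s in a..x, (x - s) ^ (γ + δ - 1) * g s := by
  have hv : IntervalIntegrable (fun r ↦ r ^ (δ - 1)) volume 0 (x - a) :=
    intervalIntegrable_rpow' (by linarith)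
  have hint := integrableOn_triangle_mul_sub_mul hax (intervalIntegrable_sub_rpow hγ x a x) hv hg
  calc ∫ t in a..x, (x - t) ^ (γ - 1) * ∫ s in a..t, (t - s) ^ (δ - 1) * g s
      = ∫ t in a..x, ∫ s in a..t, (x - t) ^ (γ - 1) * (t - s) ^ (δ - 1) * g s := by
        simp only [← intervalIntegral.integral_const_mul, mul_assoc]
    _ = ∫ s in a..x, ∫ t in s..x, (x - t) ^ (γ - 1) * (t - s) ^ (δ - 1) * g s :=
        integral_integral_triangle_swap hax hint
    _ = ∫ s in a..x, ProbabilityTheory.beta γ δ * ((x - s) ^ (γ + δ - 1) * g s) := by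
        refine integral_congr_Ioo_of_le hax fun s hs ↦ ?_
        rw [intervalIntegral.integral_mul_const, integral_sub_rpow_mul_sub_rpow hγ hδ hs.2,
          mul_assoc]
    _ = ProbabilityTheory.beta γ δ * ∫ s in a..x, (x - s) ^ (γ + δ - 1) * g s :=
        intervalIntegral.integral_const_mul _ _

theorem rlIntegral_rlIntegral (hγ : 0 ≤ γ) (hδ : 0 ≤ δ) (hε : γ + δ = ε)
    (hg : ContinuousOn g (Icc a b)) :
    EqOn (rlIntegral a γ (rlIntegral a δ g)) (rlIntegral a ε g) (Icc a b) := by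
  subst hε
  rcases hγ.eq_or_lt with rfl | hγ
  · rw [rlIntegral_zero, zero_add]
    exact eqOn_refl _ _
  rcases hδ.eq_or_lt with rfl | hδ
  · rw [rlIntegral_zero, add_zero]
    exact eqOn_refl _ _
  intro x hx
  have hΓγ := (Real.Gamma_pos_of_pos hγ).ne'
  have hΓδ := (Real.Gamma_pos_of_pos hδ).ne'
  have hkernel := integral_sub_rpow_mul_integral_sub_rpow_mul hγ hδ hx.1
    (hg.mono (Icc_subset_Icc_right hx.2))
  simp only [rlIntegral_of_pos hγ, rlIntegral_of_pos hδ, rlIntegral_of_pos (add_pos hγ hδ),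
    mul_left_comm _ (1 / Real.Gamma δ), intervalIntegral.integral_const_mul, hkernel,
    ProbabilityTheory.beta]
  field_simp

theorem hasDerivWithinAt_rlIntegral_one (hg : ContinuousOn g (Icc a b)) {x : ℝ}
    (hx : x ∈ Icc a b) : HasDerivWithinAt (rlIntegral a 1 g) (g x) (Icc a b) x := by
  have : Fact (x ∈ Icc a b) := ⟨hx⟩
  have hint : IntervalIntegrable g volume a x :=
    (hg.mono (Icc_subset_Icc_right hx.2)).intervalIntegrable_of_Icc hx.1
  rw [rlIntegral_one]
  exact integral_hasDerivWithinAt_right hint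
    (hg.stronglyMeasurableAtFilter_nhdsWithin measurableSet_Icc x) (hg x hx)

theorem hasDerivWithinAt_rlIntegral_add_one (hγ : 0 ≤ γ) (hg : ContinuousOn g (Icc a b)) {x : ℝ}
    (hx : x ∈ Icc a b) :
    HasDerivWithinAt (rlIntegral a (γ + 1) g) (rlIntegral a γ g x) (Icc a b) x := by
  have hsemi := rlIntegral_rlIntegral zero_le_one hγ (add_comm 1 γ) hg
  exact (hasDerivWithinAt_rlIntegral_one (continuousOn_rlIntegral hγ hg) hx).congr
    hsemi.symm (hsemi hx).symm

theorem eqOn_rlIntegral_one_of_hasDerivWithinAt {u : ℝ → ℝ} (hg : ContinuousOn g (Icc a b))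
    (hu : ∀ x ∈ Icc a b, HasDerivWithinAt u (g x) (Icc a b) x) (hua : u a = 0) :
    EqOn u (rlIntegral a 1 g) (Icc a b) := by
  intro x hx
  have hsub : Icc a x ⊆ Icc a b := Icc_subset_Icc_right hx.2
  simp only [rlIntegral_one]
  rw [integral_eq_sub_of_hasDerivAt_of_le hx.1
    (fun t ht ↦ (hu t (hsub ht)).continuousWithinAt.mono hsub)
    (fun t ht ↦ (hu t (hsub (Ioo_subset_Icc_self ht))).hasDerivAt
      (Icc_mem_nhds ht.1 (ht.2.trans_le hx.2)))
    ((hg.mono hsub).intervalIntegrable_of_Icc hx.1), hua, sub_zero]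

theorem contDiffOn_rlIntegral_add_natCast (hab : a < b) (hγ : 0 ≤ γ)
    (hg : ContinuousOn g (Icc a b)) (n : ℕ) :
    ContDiffOn ℝ n (rlIntegral a (γ + n) g) (Icc a b) := by
  induction n with
  | zero => simpa using continuousOn_rlIntegral hγ hg
  | succ n ih =>
    have hderiv {x : ℝ} (hx : x ∈ Icc a b) :=
      hasDerivWithinAt_rlIntegral_add_one (add_nonneg hγ n.cast_nonneg) hg hx
    push_cast
    rw [← add_assoc, contDiffOn_succ_iff_derivWithin (uniqueDiffOn_Icc hab)]
    exact ⟨fun x hx ↦ (hderiv hx).differentiableWithinAt, by simp,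
      ih.congr fun x hx ↦ (hderiv hx).derivWithin (uniqueDiffOn_Icc hab x hx)⟩

theorem iteratedDerivWithin_rlIntegral_add_natCast (hab : a < b) (hγ : 0 ≤ γ)
    (hg : ContinuousOn g (Icc a b)) (n : ℕ) :
    EqOn (iteratedDerivWithin n (rlIntegral a (γ + n) g) (Icc a b)) (rlIntegral a γ g)
      (Icc a b) := by
  induction n with
  | zero => simp [eqOn_refl]
  | succ n ih =>
    intro x hx
    rw [iteratedDerivWithin_succ', ← ih hx]
    refine iteratedDerivWithin_congr (fun y hy ↦ ?_) hx
    push_cast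
    rw [← add_assoc]
    exact (hasDerivWithinAt_rlIntegral_add_one (add_nonneg hγ n.cast_nonneg) hg hy).derivWithin
      (uniqueDiffOn_Icc hab y hy)

theorem eqOn_of_rlIntegral_eqOn (hab : a < b) (hγ : 0 ≤ γ) (hg : ContinuousOn g (Icc a b))
    (hh : ContinuousOn h (Icc a b)) (hgh : EqOn (rlIntegral a γ g) (rlIntegral a γ h) (Icc a b)) :
    EqOn g h (Icc a b) := by
  have hrec {w : ℝ → ℝ} (hw : ContinuousOn w (Icc a b)) : EqOn (iteratedDerivWithin ⌈γ⌉₊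
      (rlIntegral a (⌈γ⌉₊ - γ) (rlIntegral a γ w)) (Icc a b)) w (Icc a b) := by
    have hsemi := rlIntegral_rlIntegral (sub_nonneg.2 (Nat.le_ceil γ)) hγ
      (show ⌈γ⌉₊ - γ + γ = 0 + ⌈γ⌉₊ by ring) hw
    intro x hx
    rw [iteratedDerivWithin_congr hsemi hx,
      iteratedDerivWithin_rlIntegral_add_natCast hab le_rfl hw _ hx, rlIntegral_zero]
  intro x hx
  rw [← hrec hg hx, ← hrec hh hx]
  exact iteratedDerivWithin_congr (rlIntegral_congr _ hgh) hx

end RiemannLiouville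

section Caputo

variable {a b α β : ℝ} {k : ℕ} {f φ : ℝ → ℝ}

/-- The increment `f^(k) - f^(k)(a)` of the `k`-th derivative of `f` within `[a, b]`. For
`k < α ≤ k + 1` it is what remains of `f` once the Taylor polynomial in the Caputo derivative of
order `α` has been subtracted and the result differentiated `k` times. -/
noncomputable def derivIncrement (a b : ℝ) (k : ℕ) (f : ℝ → ℝ) (x : ℝ) : ℝ :=
  iteratedDerivWithin k f (Icc a b) x - iteratedDerivWithin k f (Icc a b) a

theorem derivIncrement_zero (a b : ℝ) (f : ℝ → ℝ) :
    derivIncrement a b 0 f = fun x ↦ f x - f a := by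
  ext x
  simp [derivIncrement]

theorem continuousOn_derivIncrement (hab : a < b) (hf : ContDiffOn ℝ k f (Icc a b)) :
    ContinuousOn (derivIncrement a b k f) (Icc a b) :=
  (hf.continuousOn_iteratedDerivWithin le_rfl (uniqueDiffOn_Icc hab)).sub continuousOn_const

theorem derivIncrement_eqOn_rlIntegral_one (hab : a < b)
    (hf : ContDiffOn ℝ (k + 1 : ℕ) f (Icc a b)) :
    EqOn (derivIncrement a b k f) (rlIntegral a 1 (iteratedDerivWithin (k + 1) f (Icc a b)))
      (Icc a b) := by
  have hu := uniqueDiffOn_Icc hab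
  refine eqOn_rlIntegral_one_of_hasDerivWithinAt
    (hf.continuousOn_iteratedDerivWithin le_rfl hu) (fun x hx ↦ ?_) (sub_self _)
  rw [iteratedDerivWithin_succ]
  exact (hf.differentiableOn_iteratedDerivWithin (mod_cast k.lt_succ_self) hu x
    hx).hasDerivWithinAt.sub_const _

theorem sub_taylorWithinEval_eqOn_rlIntegral (hab : a < b) (hf : ContDiffOn ℝ k f (Icc a b)) :
    EqOn (fun x ↦ f x - taylorWithinEval f k (Icc a b) a x)
      (rlIntegral a k (derivIncrement a b k f)) (Icc a b) := by
  induction k generalizing f with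
  | zero =>
    intro x _
    simp [rlIntegral_zero, derivIncrement_zero]
  | succ k ih =>
    have hψ := continuousOn_derivIncrement hab hf
    obtain ⟨hdiff, -, hf'⟩ := (contDiffOn_succ_iff_derivWithin (uniqueDiffOn_Icc hab)).1
      (show ContDiffOn ℝ ((k : WithTop ℕ∞) + 1) f (Icc a b) from mod_cast hf)
    have hincr : derivIncrement a b k (derivWithin f (Icc a b)) = derivIncrement a b (k + 1) f := by
      ext x
      simp only [derivIncrement, iteratedDerivWithin_succ']
    have hderiv : ∀ x ∈ Icc a b,
        HasDerivWithinAt (fun x ↦ f x - taylorWithinEval f (k + 1) (Icc a b) a x)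
          (rlIntegral a k (derivIncrement a b (k + 1) f) x) (Icc a b) x := fun x hx ↦ by
      rw [← hincr, ← ih hf' hx]
      exact (hdiff x hx).hasDerivWithinAt.sub
        (hasDerivAt_taylorWithinEval_succ f k).hasDerivWithinAt
    have hone := eqOn_rlIntegral_one_of_hasDerivWithinAt
      (continuousOn_rlIntegral k.cast_nonneg hψ) hderiv (by simp)
    exact hone.trans (rlIntegral_rlIntegral zero_le_one k.cast_nonneg (by push_cast; ring) hψ)

theorem natCast_lt_and_le_add_one_of_ceil_eq (hk : ⌈α⌉₊ = k + 1) : (k : ℝ) < α ∧ α ≤ k + 1 := by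
  simpa using (Nat.ceil_eq_iff k.succ_ne_zero).1 hk

theorem contCaputoDiff_iff_of_ceil_eq (hk : ⌈α⌉₊ = k + 1) :
    ContCaputoDiff a b α f ↔ ContDiffOn ℝ k f (Icc a b) ∧
      ContDiffOn ℝ (k + 1 : ℕ) (rlIntegral a (k + 1 - α) (taylorRemainder a b α f)) (Icc a b) := by
  have hα : α ≠ 0 := by rintro rfl; simp at hk
  simp [ContCaputoDiff, hα, hk]

theorem caputoDeriv_of_ceil_eq (hk : ⌈α⌉₊ = k + 1) :
    caputoDeriv a b α f = iteratedDerivWithin (k + 1)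
      (rlIntegral a (k + 1 - α) (taylorRemainder a b α f)) (Icc a b) := by
  have hα : α ≠ 0 := by rintro rfl; simp at hk
  ext x
  simp [caputoDeriv, rlDeriv, hα, hk]

theorem continuousOn_caputoDeriv (hab : a < b) (hf : ContCaputoDiff a b α f) :
    ContinuousOn (caputoDeriv a b α f) (Icc a b) := by
  by_cases hα : α = 0
  · rw [ContCaputoDiff, if_pos hα] at hf
    exact hf.congr fun _ _ ↦ if_pos hα
  · rw [ContCaputoDiff, if_neg hα] at hf
    exact (hf.2.continuousOn_iteratedDerivWithin le_rfl (uniqueDiffOn_Icc hab)).congr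
      fun _ _ ↦ if_neg hα

theorem rlIntegral_taylorRemainder_eqOn (hab : a < b) (hk : ⌈α⌉₊ = k + 1)
    (hf : ContDiffOn ℝ k f (Icc a b)) :
    EqOn (rlIntegral a (k + 1 - α) (taylorRemainder a b α f))
      (rlIntegral a (k + 1 - α + k) (derivIncrement a b k f)) (Icc a b) := by
  have hαk := (natCast_lt_and_le_add_one_of_ceil_eq hk).2
  have hrem : taylorRemainder a b α f = fun x ↦ f x - taylorWithinEval f k (Icc a b) a x := by
    ext x
    simp [taylorRemainder, hk]
  rw [hrem]
  exact (rlIntegral_congr _ (sub_taylorWithinEval_eqOn_rlIntegral hab hf)).trans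
    (rlIntegral_rlIntegral (sub_nonneg.2 hαk) k.cast_nonneg rfl
      (continuousOn_derivIncrement hab hf))

theorem contCaputoDiff_of_derivIncrement_eqOn (hab : a < b) (hk : ⌈α⌉₊ = k + 1)
    (hf : ContDiffOn ℝ k f (Icc a b)) (hφ : ContinuousOn φ (Icc a b))
    (hψ : EqOn (derivIncrement a b k f) (rlIntegral a (α - k) φ) (Icc a b)) :
    ContCaputoDiff a b α f ∧ EqOn (caputoDeriv a b α f) φ (Icc a b) := by
  obtain ⟨hkα, hαk⟩ := natCast_lt_and_le_add_one_of_ceil_eq hk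
  have hrem : EqOn (rlIntegral a (k + 1 - α) (taylorRemainder a b α f))
      (rlIntegral a (0 + (k + 1 : ℕ)) φ) (Icc a b) :=
    (rlIntegral_taylorRemainder_eqOn hab hk hf).trans <| (rlIntegral_congr _ hψ).trans <|
      rlIntegral_rlIntegral (add_nonneg (sub_nonneg.2 hαk) k.cast_nonneg) (sub_nonneg.2 hkα.le)
        (by push_cast; ring) hφ
  refine ⟨(contCaputoDiff_iff_of_ceil_eq hk).2
    ⟨hf, (contDiffOn_rlIntegral_add_natCast hab le_rfl hφ _).congr hrem⟩, fun x hx ↦ ?_⟩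
  rw [caputoDeriv_of_ceil_eq hk, iteratedDerivWithin_congr hrem hx,
    iteratedDerivWithin_rlIntegral_add_natCast hab le_rfl hφ _ hx, rlIntegral_zero]

theorem hasDerivWithinAt_rlIntegral_derivIncrement (hab : a < b) (hk : ⌈α⌉₊ = k + 1)
    (hf : ContCaputoDiff a b α f) {x : ℝ} (hx : x ∈ Icc a b) :
    HasDerivWithinAt (rlIntegral a (k + 1 - α) (derivIncrement a b k f))
      (caputoDeriv a b α f x) (Icc a b) x := by
  have hαk := (natCast_lt_and_le_add_one_of_ceil_eq hk).2
  obtain ⟨hfk, hsmooth⟩ := (contCaputoDiff_iff_of_ceil_eq hk).1 hf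
  have hderiv : EqOn (iteratedDerivWithin k
      (rlIntegral a (k + 1 - α) (taylorRemainder a b α f)) (Icc a b))
      (rlIntegral a (k + 1 - α) (derivIncrement a b k f)) (Icc a b) := fun y hy ↦
    (iteratedDerivWithin_congr (rlIntegral_taylorRemainder_eqOn hab hk hfk) hy).trans
      (iteratedDerivWithin_rlIntegral_add_natCast hab (sub_nonneg.2 hαk)
        (continuousOn_derivIncrement hab hfk) k hy)
  rw [caputoDeriv_of_ceil_eq hk, iteratedDerivWithin_succ]
  exact (hsmooth.differentiableOn_iteratedDerivWithin (mod_cast k.lt_succ_self)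
    (uniqueDiffOn_Icc hab) x hx).hasDerivWithinAt.congr hderiv.symm (hderiv hx).symm

theorem ContCaputoDiff.derivIncrement_eqOn (hab : a < b) (hk : ⌈α⌉₊ = k + 1)
    (hf : ContCaputoDiff a b α f) :
    EqOn (derivIncrement a b k f) (rlIntegral a (α - k) (caputoDeriv a b α f)) (Icc a b) := by
  obtain ⟨hkα, hαk⟩ := natCast_lt_and_le_add_one_of_ceil_eq hk
  have hφ := continuousOn_caputoDeriv hab hf
  have hψ := continuousOn_derivIncrement hab ((contCaputoDiff_iff_of_ceil_eq hk).1 hf).1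
  have hγ : 0 ≤ k + 1 - α := sub_nonneg.2 hαk
  have hδ : 0 ≤ α - k := sub_nonneg.2 hkα.le
  have hleft : rlIntegral a (k + 1 - α) (derivIncrement a b k f) a = 0 := by
    rcases hγ.eq_or_lt with h | h
    · rw [← h, rlIntegral_zero, derivIncrement, sub_self]
    · exact rlIntegral_left h _ _
  have hone := eqOn_rlIntegral_one_of_hasDerivWithinAt hφ
    (fun x hx ↦ hasDerivWithinAt_rlIntegral_derivIncrement hab hk hf hx) hleft
  have hsemi := rlIntegral_rlIntegral hγ hδ (show k + 1 - α + (α - k) = 1 by ring) hφ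
  exact eqOn_of_rlIntegral_eqOn hab hγ hψ (continuousOn_rlIntegral hδ hφ) (hone.trans hsemi.symm)

theorem contCaputoDiff_natCast (hab : a < b) (hf : ContDiffOn ℝ k f (Icc a b)) :
    ContCaputoDiff a b k f ∧
      EqOn (caputoDeriv a b k f) (iteratedDerivWithin k f (Icc a b)) (Icc a b) := by
  cases k with
  | zero => exact ⟨by simpa [ContCaputoDiff] using hf, fun x _ ↦ by simp [caputoDeriv]⟩
  | succ n =>
    refine contCaputoDiff_of_derivIncrement_eqOn hab (Nat.ceil_natCast _)
      (hf.of_le (mod_cast n.le_succ))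
      (hf.continuousOn_iteratedDerivWithin le_rfl (uniqueDiffOn_Icc hab)) ?_
    simpa using derivIncrement_eqOn_rlIntegral_one hab hf

theorem ContCaputoDiff.of_lt_of_ceil_eq (hab : a < b) (hβα : β < α) (hk : ⌈β⌉₊ = k + 1)
    (hk' : ⌈α⌉₊ = k + 1) (hf : ContCaputoDiff a b α f) :
    ContCaputoDiff a b β f ∧
      EqOn (caputoDeriv a b β f) (rlIntegral a (α - β) (caputoDeriv a b α f)) (Icc a b) := by
  have hkβ := (natCast_lt_and_le_add_one_of_ceil_eq hk).1
  have hφ := continuousOn_caputoDeriv hab hf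
  have hδ : 0 ≤ α - β := sub_nonneg.2 hβα.le
  refine contCaputoDiff_of_derivIncrement_eqOn hab hk ((contCaputoDiff_iff_of_ceil_eq hk').1 hf).1
    (continuousOn_rlIntegral hδ hφ) ?_
  exact (hf.derivIncrement_eqOn hab hk').trans
    (rlIntegral_rlIntegral (sub_nonneg.2 hkβ.le) hδ (by ring) hφ).symm

theorem ContCaputoDiff.lower_order (hab : a < b) (hk : ⌈α⌉₊ = k + 1) (hkβ : k ≤ β) (hβα : β < α)
    (hf : ContCaputoDiff a b α f) :
    ContCaputoDiff a b β f ∧ (k < β → caputoDeriv a b β f a = 0) ∧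
      EqOn (fun x ↦ caputoDeriv a b β f x - caputoDeriv a b β f a)
        (rlIntegral a (α - β) (caputoDeriv a b α f)) (Icc a b) := by
  have ha : a ∈ Icc a b := left_mem_Icc.2 hab.le
  rcases hkβ.eq_or_lt with rfl | hkβ
  · obtain ⟨hkf, hD⟩ := contCaputoDiff_natCast hab ((contCaputoDiff_iff_of_ceil_eq hk).1 hf).1
    refine ⟨hkf, fun h ↦ (lt_irrefl _ h).elim, fun x hx ↦ ?_⟩
    simp only [hD hx, hD ha]
    exact hf.derivIncrement_eqOn hab hk hx
  · have hβk : β ≤ k + 1 := hβα.le.trans (natCast_lt_and_le_add_one_of_ceil_eq hk).2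
    have hceil : ⌈β⌉₊ = k + 1 := (Nat.ceil_eq_iff k.succ_ne_zero).2 (by simpa using ⟨hkβ, hβk⟩)
    obtain ⟨hβf, hD⟩ := hf.of_lt_of_ceil_eq hab hβα hceil hk
    have hzero : caputoDeriv a b β f a = 0 := (hD ha).trans (rlIntegral_left (sub_pos.2 hβα) _ _)
    exact ⟨hβf, fun _ ↦ hzero, fun x hx ↦ by simpa only [hzero, sub_zero] using hD hx⟩

theorem contCaputoDiff_of_sub_eqOn_rlIntegral (hab : a < b) (hα : 0 < α) (hα1 : α ≤ 1)
    (hf : ContinuousOn f (Icc a b)) (hφ : ContinuousOn φ (Icc a b))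
    (h : EqOn (fun x ↦ f x - f a) (rlIntegral a α φ) (Icc a b)) :
    ContCaputoDiff a b α f ∧ EqOn (caputoDeriv a b α f) φ (Icc a b) := by
  have hceil : ⌈α⌉₊ = 0 + 1 := (Nat.ceil_eq_iff one_ne_zero).2 (by simpa using ⟨hα, hα1⟩)
  refine contCaputoDiff_of_derivIncrement_eqOn hab hceil (by simpa using hf) hφ ?_
  rwa [derivIncrement_zero, Nat.cast_zero, sub_zero]

end Caputo

end FracCalc

theorem theorem3p4 (a b : ℝ) (hab : a < b) (α β : ℝ) (hα : 0 < α)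
    (hβ : (⌈α⌉₊ : ℝ) - 1 ≤ β) (hβα : β < α) (f : ℝ → ℝ)
    (hf : ContDiffOn ℝ ((⌈α⌉₊ - 1 : ℕ) : WithTop ℕ∞) f (Set.Icc a b))
    (hfα : FracCalc.ContCaputoDiff a b α f) :
    (FracCalc.ContCaputoDiff a b β f ∧
      ContinuousOn (FracCalc.caputoDeriv a b β f) (Set.Icc a b) ∧
      ((¬ ∃ n : ℕ, β = n) → FracCalc.caputoDeriv a b β f a = 0)) ∧
    (FracCalc.ContCaputoDiff a b (α - β) (FracCalc.caputoDeriv a b β f) ∧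
      ContinuousOn (FracCalc.caputoDeriv a b (α - β) (FracCalc.caputoDeriv a b β f))
        (Set.Icc a b) ∧
      Set.EqOn (FracCalc.caputoDeriv a b (α - β) (FracCalc.caputoDeriv a b β f))
        (FracCalc.caputoDeriv a b α f) (Set.Icc a b)) := by
  obtain ⟨k, hk⟩ := Nat.exists_eq_add_one.2 (Nat.ceil_pos.2 hα)
  have hkβ : k ≤ β := by simpa [hk] using hβ
  have hα_sub_β : α - β ≤ 1 := by
    linarith [(FracCalc.natCast_lt_and_le_add_one_of_ceil_eq hk).2]
  obtain ⟨hβf, hzero, hsub⟩ := hfα.lower_order hab hk hkβ hβα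
  have hβcont := FracCalc.continuousOn_caputoDeriv hab hβf
  obtain ⟨hdiff, heq⟩ := FracCalc.contCaputoDiff_of_sub_eqOn_rlIntegral hab (sub_pos.2 hβα)
    hα_sub_β hβcont (FracCalc.continuousOn_caputoDeriv hab hfα) hsub
  have hβzero : (¬ ∃ n : ℕ, β = n) → FracCalc.caputoDeriv a b β f a = 0 := fun hβnat ↦
    hzero (hkβ.lt_of_ne fun h ↦ hβnat ⟨k, h.symm⟩)
  exact ⟨⟨hβf, hβcont, hβzero⟩, hdiff, FracCalc.continuousOn_caputoDeriv hab hdiff, heq⟩
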